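/- Let $\mathbb H$ be a separable (real) Hilbert space with norm $\|\cdot\|_{\mathbb H}$, and let $(D_j)_{j\ge 1}$ be an $\mathbb H$-valued square-integrable martingale difference sequence with respect to a filtration $(\mathcal F_j)_{j\ge 0}$ on a probability space, that is, for every $j\ge 1$, $D_j$ is $\mathcal F_j$-measurable, $\mathbb E\|D_j\|_{\mathbb H}^2<\infty$ and $\mathbb E[D_j\mid\mathcal F_{j-1}]=0$ a.s. Suppose that for every $j\ge 1$, $$\mathbb E\big[\|D_j\|_{\mathbb H}^2\mid\mathcal F_{j-1}\big]=\mathbb E\big[\|D_j\|_{\mathbb H}^2\mid\mathcal F_{0}\big]\quad\text{a.s.}$$ Then for every integer $n\ge 1$ and all real $x>0$ and $y>0$, $$\mathbb P\Big(\max_{1\le k\le n}\Big\|\sum_{j=1}^k D_j\Big\|_{\mathbb H}>x\Big)\le 4\exp\Big(-\frac{x^2}{y^2}\Big)+4\int_1^\infty u\,\mathbb P\Bigg(\sqrt{\sum_{j=1}^n\|D_j\|_{\mathbb H}^2}>y\,\frac u8\Bigg)\,du,$$ where the integral on the right-hand side is finite. -/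

import Mathlib

open MeasureTheory

/-- `(D j)_{j ≥ 1}` is a martingale difference sequence with respect to the filtration
`(ℱ j)_{j ≥ 0}`: for every `j ≥ 1`, the variable `D j` is `ℱ j`-measurable, integrable, and
`E[D j | ℱ (j - 1)] = 0` almost surely. The value `D 0` plays no role. -/
structure IsMartingaleDifference {Ω H : Type*} [NormedAddCommGroup H] [NormedSpace ℝ H]
    {m0 : MeasurableSpace Ω} (D : ℕ → Ω → H) (ℱ : Filtration ℕ m0) (μ : Measure Ω) : Prop where
  stronglyMeasurable : ∀ j, 1 ≤ j → StronglyMeasurable[ℱ j] (D j)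
  integrable : ∀ j, 1 ≤ j → Integrable (D j) μ
  condExp_eq_zero : ∀ j, 1 ≤ j → μ[D j | ℱ (j - 1)] =ᵐ[μ] 0

/-! At scale `l`, the exponential of `√(1 + ‖l S_k‖²)`, compensated by `∑ ‖l D_j‖²` and by half the
conditional variances, is a supermartingale (`supermartingale_expSqrtProcess`). The smooth surrogate
for the norm allows a second-order expansion in a Hilbert space, and the maximal inequality gives a
Gaussian bound while both variations are at most `2t`, `t = y² / 64`. By the variance hypothesis the
conditional variation is `E[Q | ℱ 0]`, `Q = ∑ ‖D_j‖²`, so Markov's inequality bounds each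
exceptional event, `Q > 2t` and `E[Q | ℱ 0] > 2t`, by `E (Q - t)⁺ / t`. By the layer-cake formula
this is twice the tail integral. -/

/-! ### Deterministic inequalities for one increment -/

open Real in
theorem exp_sub_sq_le (t q : ℝ) (h : t ^ 2 ≤ q) : exp (t - q / 2) ≤ 1 + t + q / 2 := by
  have h1 : exp (t - t ^ 2 / 2) * (1 - (t - t ^ 2 / 2)) ≤ 1 := by
    have := one_sub_le_exp_neg (t - t ^ 2 / 2)
    calc _ ≤ exp (t - t ^ 2 / 2) * exp (-(t - t ^ 2 / 2)) := by gcongr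
      _ = 1 := by rw [← exp_add]; simp
  have h2 : exp (t - t ^ 2 / 2) ≤ 1 + t + t ^ 2 / 2 := by
    have hp : 0 < 1 - (t - t ^ 2 / 2) := by nlinarith [sq_nonneg (t - 1)]
    refine le_of_mul_le_mul_right (h1.trans ?_) hp
    -- `(1 + t + t²/2)(1 - t + t²/2) = 1 + t⁴/4`.
    nlinarith [sq_nonneg (t ^ 2)]
  have h3 : exp (t - q / 2) ≤ exp (t - t ^ 2 / 2) := exp_le_exp.2 (by linarith)
  linarith

theorem sqrt_one_add_norm_add_sq_le {H : Type*} [NormedAddCommGroup H] [InnerProductSpace ℝ H]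
    (s d : H) :
    √(1 + ‖s + d‖ ^ 2) ≤ √(1 + ‖s‖ ^ 2) + inner ℝ s d / √(1 + ‖s‖ ^ 2) + ‖d‖ ^ 2 / 2 := by
  have hN : 1 ≤ √(1 + ‖s‖ ^ 2) := Real.one_le_sqrt.2 (by nlinarith [norm_nonneg s])
  have hN2 : √(1 + ‖s‖ ^ 2) ^ 2 = 1 + ‖s‖ ^ 2 := Real.sq_sqrt (by positivity)
  set N := √(1 + ‖s‖ ^ 2)
  have key : √(1 + ‖s + d‖ ^ 2) ≤ N + inner ℝ s d / N + ‖d‖ ^ 2 / (2 * N) := by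
    have hM : √(1 + ‖s + d‖ ^ 2) ^ 2 = 1 + ‖s + d‖ ^ 2 := Real.sq_sqrt (by positivity)
    set M := √(1 + ‖s + d‖ ^ 2)
    rw [norm_add_sq_real] at hM
    have : N + inner ℝ s d / N + ‖d‖ ^ 2 / (2 * N) = (M ^ 2 + N ^ 2) / (2 * N) := by
      field_simp
      linarith
    rw [this, le_div_iff₀ (by linarith)]
    -- AM-GM: the tangent to the square root at `N²` lies above it.
    nlinarith [sq_nonneg (M - N)]
  refine key.trans ?_
  gcongr
  linarith

theorem sq_inner_div_sqrt_le {H : Type*} [NormedAddCommGroup H] [InnerProductSpace ℝ H]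
    (s d : H) : (inner ℝ s d / √(1 + ‖s‖ ^ 2)) ^ 2 ≤ ‖d‖ ^ 2 := by
  have hN2 : √(1 + ‖s‖ ^ 2) ^ 2 = 1 + ‖s‖ ^ 2 := Real.sq_sqrt (by positivity)
  rw [div_pow, hN2, div_le_iff₀ (by positivity)]
  have h := sq_le_sq' (neg_le_of_abs_le (abs_real_inner_le_norm s d))
    (le_of_abs_le (abs_real_inner_le_norm s d))
  nlinarith [sq_nonneg ‖d‖]

/-- Half of `‖d‖²` absorbs the second-order term of the square root; the other half compensates the
exponential of the linear term. -/
theorem exp_sqrt_one_add_norm_add_sq_le {H : Type*} [NormedAddCommGroup H]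
    [InnerProductSpace ℝ H] (s d : H) :
    Real.exp (√(1 + ‖s + d‖ ^ 2) - ‖d‖ ^ 2) ≤ Real.exp (√(1 + ‖s‖ ^ 2)) *
      (1 + inner ℝ s d / √(1 + ‖s‖ ^ 2) + ‖d‖ ^ 2 / 2) := by
  refine le_trans ?_ (mul_le_mul_of_nonneg_left
    (exp_sub_sq_le _ _ (sq_inner_div_sqrt_le s d)) (Real.exp_pos _).le)
  rw [← Real.exp_add, Real.exp_le_exp]
  linarith [sqrt_one_add_norm_add_sq_le s d]

theorem sqrt_one_add_norm_add_sq_sub_le {H : Type*} [NormedAddCommGroup H]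
    [InnerProductSpace ℝ H] (s d : H) :
    √(1 + ‖s + d‖ ^ 2) - ‖d‖ ^ 2 ≤ √(1 + ‖s‖ ^ 2) + 1 := by
  have h1 := sqrt_one_add_norm_add_sq_le s d
  have h2 := le_of_abs_le (sq_le_sq.1 (sq_inner_div_sqrt_le s d) |>.trans_eq (abs_norm d))
  nlinarith [sq_nonneg (‖d‖ - 1)]

/-- Makes the exponential process bounded at each time, hence integrable without exponential
moments. -/
theorem sqrt_one_add_norm_sum_sq_sub_le {H : Type*} [NormedAddCommGroup H]
    [InnerProductSpace ℝ H] (d : ℕ → H) (k : ℕ) :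
    √(1 + ‖∑ j ∈ Finset.Icc 1 k, d j‖ ^ 2) - ∑ j ∈ Finset.Icc 1 k, ‖d j‖ ^ 2 ≤ 1 + k := by
  induction k with
  | zero => simp
  | succ k ih =>
    rw [Finset.sum_Icc_succ_top (by omega), Finset.sum_Icc_succ_top (by omega)]
    have := sqrt_one_add_norm_add_sq_sub_le (∑ j ∈ Finset.Icc 1 k, d j) (d (k + 1))
    push_cast
    linarith

/-! ### Maximal inequality and tail integrals -/

theorem MeasureTheory.Supermartingale.mul_measureReal_exists_le {Ω : Type*}
    {m0 : MeasurableSpace Ω} {μ : Measure Ω} [IsFiniteMeasure μ] {ℱ : Filtration ℕ m0}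
    {f : ℕ → Ω → ℝ} (hf : Supermartingale f ℱ μ) (hnonneg : ∀ k ω, 0 ≤ f k ω) (c : ℝ) (n : ℕ) :
    c * μ.real {ω | ∃ k ≤ n, c ≤ f k ω} ≤ ∫ ω, f 0 ω ∂μ := by
  have hτ : IsStoppingTime ℱ (fun ω ↦ ((hittingBtwn f (Set.Ici c) 0 n ω : ℕ) : ℕ∞)) :=
    hf.stronglyAdapted.adapted.isStoppingTime_hittingBtwn measurableSet_Ici
  set τ : Ω → ℕ∞ := fun ω ↦ ((hittingBtwn f (Set.Ici c) 0 n ω : ℕ) : ℕ∞)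
  have hle : ∀ ω, τ ω ≤ n := fun ω ↦ Nat.cast_le.2 (hittingBtwn_le (u := f) ω)
  have hmono := hf.neg.expected_stoppedValue_mono (isStoppingTime_const ℱ 0) hτ
    (fun ω ↦ zero_le) hle
  have hint : Integrable (stoppedValue f τ) μ :=
    integrable_stoppedValue ℕ hτ hf.integrable hle
  have h1 : ∫ ω, stoppedValue f τ ω ∂μ ≤ ∫ ω, f 0 ω ∂μ := by
    have e1 : stoppedValue (-f) τ = fun ω ↦ - stoppedValue f τ ω := rfl
    have e2 : stoppedValue (-f) (fun _ ↦ ((0 : ℕ) : ℕ∞)) = fun ω ↦ - f 0 ω := rfl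
    have := hmono
    erw [e1, e2, integral_neg, integral_neg] at this
    linarith
  by_cases hc : 0 ≤ c
  swap
  · exact (mul_nonpos_of_nonpos_of_nonneg (not_le.1 hc).le measureReal_nonneg).trans
      (integral_nonneg (hnonneg 0))
  refine le_trans ?_ ((mul_meas_ge_le_integral_of_nonneg (Filter.Eventually.of_forall
    fun ω ↦ hnonneg _ ω) hint c).trans h1)
  gcongr
  · exact measure_ne_top _ _
  · intro hω
    obtain ⟨k, hk, hck⟩ := hω
    exact stoppedValue_hittingBtwn_mem ⟨k, ⟨zero_le, hk⟩, hck⟩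

/-- Since `Q ≤ (Q - t)⁺ + t`, the event forces `E[(Q - t)⁺ | m] > t`; Markov's inequality applies.
-/
theorem measureReal_lt_condExp_le {Ω : Type*} {m m0 : MeasurableSpace Ω} (hm : m ≤ m0)
    (μ : Measure Ω) [IsProbabilityMeasure μ] {Q : Ω → ℝ} (hQ : Integrable Q μ) {t : ℝ}
    (ht : 0 < t) : t * μ.real {ω | 2 * t < (μ[Q | m]) ω} ≤ ∫ ω, max (Q ω - t) 0 ∂μ := by
  have hi : Integrable (fun ω ↦ max (Q ω - t) 0) μ := (hQ.sub (integrable_const t)).pos_part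
  have h1 : μ[Q | m] ≤ᵐ[μ] μ[fun ω ↦ max (Q ω - t) 0 + t | m] :=
    condExp_mono hQ (hi.add (integrable_const t)) (Filter.Eventually.of_forall fun ω ↦ by
      linarith [le_max_left (Q ω - t) 0])
  have h2 : μ[fun ω ↦ max (Q ω - t) 0 + t | m] =ᵐ[μ] _ := condExp_add hi (integrable_const t) m
  have h3 : 0 ≤ᵐ[μ] μ[fun ω ↦ max (Q ω - t) 0 | m] :=
    condExp_nonneg (Filter.Eventually.of_forall fun ω ↦ le_max_right _ _)
  rw [← integral_condExp hm (f := fun ω ↦ max (Q ω - t) 0)]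
  refine le_trans ?_ (mul_meas_ge_le_integral_of_nonneg h3 integrable_condExp t)
  refine mul_le_mul_of_nonneg_left (ENNReal.toReal_mono (measure_ne_top _ _)
    (measure_mono_ae ?_)) ht.le
  filter_upwards [h1, h2] with ω h1 h2 (h : 2 * t < _)
  change t ≤ _
  rw [h2, Pi.add_apply, condExp_const hm] at h1
  linarith

theorem integrableOn_mul_measureReal_lt_and_integral_eq {Ω : Type*} {m0 : MeasurableSpace Ω}
    (μ : Measure Ω) [IsProbabilityMeasure μ] {R : Ω → ℝ} (hR : AEMeasurable R μ)
    (hR0 : ∀ ω, 0 ≤ R ω)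
    (hR2 : Integrable (fun ω ↦ R ω ^ 2) μ) :
    IntegrableOn (fun u : ℝ ↦ u * μ.real {ω | u < R ω}) (Set.Ioi 1) ∧
    ∫ u in Set.Ioi (1 : ℝ), u * μ.real {ω | u < R ω} = ∫ ω, max (R ω ^ 2 - 1) 0 / 2 ∂μ := by
  have hi : Integrable (fun ω ↦ max (R ω ^ 2 - 1) 0 / 2) μ :=
    (hR2.sub (integrable_const 1)).pos_part.div_const 2
  -- Layer cake for `(R - 1)⁺` with density `t + 1`; the shift `u = t + 1` makes the integral start
  -- at 1.
  have key := lintegral_comp_eq_lintegral_meas_lt_mul μ (f := fun ω ↦ max (R ω - 1) 0)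
    (g := fun t ↦ t + 1) (Filter.Eventually.of_forall fun ω ↦ le_max_right _ _)
    ((hR.sub_const 1).max aemeasurable_const)
    (fun t _ ↦ (by fun_prop : Continuous fun t : ℝ ↦ t + 1).intervalIntegrable _ _)
    ((ae_restrict_iff' measurableSet_Ioi).2 (Filter.Eventually.of_forall fun t ht ↦ by
      have : (0 : ℝ) < t := ht
      simp; linarith))
  have hl : ∀ ω, ∫ t in (0 : ℝ)..max (R ω - 1) 0, (t + 1) = max (R ω ^ 2 - 1) 0 / 2 := by
    intro ω
    rw [intervalIntegral.integral_add (by simp) (by simp), integral_id]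
    simp only [intervalIntegral.integral_const, smul_eq_mul]
    rcases le_total (R ω) 1 with h | h
    · rw [max_eq_right (by linarith), max_eq_right (by nlinarith [hR0 ω])]; ring
    · rw [max_eq_left (by linarith), max_eq_left (by nlinarith)]; ring
  simp_rw [hl] at key
  have hr : ∫⁻ t in Set.Ioi (0 : ℝ), μ {ω | t < max (R ω - 1) 0} * ENNReal.ofReal (t + 1) =
      ∫⁻ u in Set.Ioi (1 : ℝ), ENNReal.ofReal (u * μ.real {ω | u < R ω}) := by
    rw [← lintegral_indicator measurableSet_Ioi, ← lintegral_indicator measurableSet_Ioi,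
      ← lintegral_add_right_eq_self ((Set.Ioi (1 : ℝ)).indicator _) (1 : ℝ)]
    refine lintegral_congr fun t ↦ ?_
    by_cases ht : 0 < t
    · rw [Set.indicator_of_mem (by exact ht), Set.indicator_of_mem (by simpa using ht),
        ENNReal.ofReal_mul (by linarith), mul_comm, ofReal_measureReal]
      congr 3
      ext ω
      simp [ht.not_gt, lt_sub_iff_add_lt]
    · rw [Set.indicator_of_notMem (by exact ht), Set.indicator_of_notMem (by simpa using ht)]
  rw [hr] at key
  have hanti : Antitone fun u : ℝ ↦ μ.real {ω | u < R ω} := fun a b hab ↦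
    measureReal_mono fun ω (h : b < R ω) ↦ lt_of_le_of_lt hab h
  have hmeas : AEStronglyMeasurable (fun u : ℝ ↦ u * μ.real {ω | u < R ω})
      (volume.restrict (Set.Ioi 1)) :=
    (measurable_id.mul hanti.measurable).aestronglyMeasurable
  have hnn : 0 ≤ᵐ[volume.restrict (Set.Ioi (1 : ℝ))] fun u : ℝ ↦ u * μ.real {ω | u < R ω} :=
    (ae_restrict_iff' measurableSet_Ioi).2 (Filter.Eventually.of_forall fun u hu ↦
      mul_nonneg (zero_le_one.trans (le_of_lt hu)) measureReal_nonneg)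
  have hnn' : 0 ≤ᵐ[μ] fun ω ↦ max (R ω ^ 2 - 1) 0 / 2 :=
    Filter.Eventually.of_forall fun ω ↦ div_nonneg (le_max_right _ _) zero_le_two
  refine ⟨⟨hmeas, ?_⟩, ?_⟩
  · rw [hasFiniteIntegral_iff_ofReal hnn, ← key]
    exact (hasFiniteIntegral_iff_ofReal hnn').1 hi.2
  · rw [integral_eq_lintegral_of_nonneg_ae hnn hmeas, ← key,
      integral_eq_lintegral_of_nonneg_ae hnn' hi.1]

theorem ae_condExp_norm_sq_nonneg {Ω H : Type*} {m0 : MeasurableSpace Ω} {μ : Measure Ω}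
    [NormedAddCommGroup H] {ℱ : Filtration ℕ m0} {D : ℕ → Ω → H} :
    ∀ᵐ ω ∂μ, ∀ j, 0 ≤ (μ[fun ω ↦ ‖D j ω‖ ^ 2 | ℱ (j - 1)]) ω :=
  ae_all_iff.2 fun _ ↦ condExp_nonneg (Filter.Eventually.of_forall fun _ ↦ by positivity)

/-! ### The exponential supermartingale -/

section ExponentialSupermartingale

variable {Ω H : Type*} {m0 : MeasurableSpace Ω} {μ : Measure Ω}
  [NormedAddCommGroup H] [InnerProductSpace ℝ H] {ℱ : Filtration ℕ m0} {D : ℕ → Ω → H}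

/-- The exponential process attached to a sequence `D` at scale `l`, compensated both by its
quadratic variation and by its conditional quadratic variation. -/
noncomputable def expSqrtProcess (D : ℕ → Ω → H) (ℱ : Filtration ℕ m0) (μ : Measure Ω) (l : ℝ)
    (k : ℕ) (ω : Ω) : ℝ :=
  Real.exp (√(1 + ‖∑ j ∈ Finset.Icc 1 k, l • D j ω‖ ^ 2) - ∑ j ∈ Finset.Icc 1 k, ‖l • D j ω‖ ^ 2) *
    Real.exp (-(∑ j ∈ Finset.Icc 1 k, l ^ 2 * (μ[fun ω ↦ ‖D j ω‖ ^ 2 | ℱ (j - 1)]) ω / 2))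

theorem stronglyMeasurable_sum_smul (hD : ∀ j, 1 ≤ j → StronglyMeasurable[ℱ j] (D j)) (l : ℝ)
    (k : ℕ) : StronglyMeasurable[ℱ k] fun ω ↦ ∑ j ∈ Finset.Icc 1 k, l • D j ω :=
  Finset.stronglyMeasurable_fun_sum _ fun j hj ↦
    ((hD j (Finset.mem_Icc.1 hj).1).mono (ℱ.mono (Finset.mem_Icc.1 hj).2)).const_smul l

theorem stronglyMeasurable_expSqrtProcess
    (hD : ∀ j, 1 ≤ j → StronglyMeasurable[ℱ j] (D j)) (l : ℝ) (k : ℕ) :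
    StronglyMeasurable[ℱ k] (expSqrtProcess D ℱ μ l k) := by
  have h1 := stronglyMeasurable_sum_smul hD l k
  have h2 : StronglyMeasurable[ℱ k] fun ω ↦ ∑ j ∈ Finset.Icc 1 k, ‖l • D j ω‖ ^ 2 :=
    Finset.stronglyMeasurable_fun_sum _ fun j hj ↦
      (((hD j (Finset.mem_Icc.1 hj).1).mono (ℱ.mono (Finset.mem_Icc.1 hj).2)).const_smul l).norm.pow 2
  have h3 : StronglyMeasurable[ℱ k] fun ω ↦ ∑ j ∈ Finset.Icc 1 k,
      l ^ 2 * (μ[fun ω ↦ ‖D j ω‖ ^ 2 | ℱ (j - 1)]) ω / 2 :=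
    Finset.stronglyMeasurable_fun_sum _ fun j hj ↦ by
      have : StronglyMeasurable[ℱ k] (μ[fun ω ↦ ‖D j ω‖ ^ 2 | ℱ (j - 1)]) :=
        stronglyMeasurable_condExp.mono (ℱ.mono (by have := (Finset.mem_Icc.1 hj).2; omega))
      simp_rw [div_eq_mul_inv]
      exact (this.const_mul _).mul_const _
  have h4 : StronglyMeasurable[ℱ k] fun ω ↦ √(1 + ‖∑ j ∈ Finset.Icc 1 k, l • D j ω‖ ^ 2) :=
    Real.continuous_sqrt.comp_stronglyMeasurable (stronglyMeasurable_const.add (h1.norm.pow 2))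
  exact (Real.continuous_exp.comp_stronglyMeasurable (h4.sub h2)).mul
    (Real.continuous_exp.comp_stronglyMeasurable h3.neg)

theorem expSqrtProcess_nonneg (l : ℝ) (k : ℕ) (ω : Ω) : 0 ≤ expSqrtProcess D ℱ μ l k ω := by
  unfold expSqrtProcess; positivity

theorem ae_expSqrtProcess_le (l : ℝ) (k : ℕ) :
    ∀ᵐ ω ∂μ, expSqrtProcess D ℱ μ l k ω ≤ Real.exp (1 + k) := by
  filter_upwards [ae_condExp_norm_sq_nonneg (D := D) (ℱ := ℱ) (μ := μ)] with ω hω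
  rw [expSqrtProcess, ← Real.exp_add, Real.exp_le_exp]
  have h1 := sqrt_one_add_norm_sum_sq_sub_le (fun j ↦ l • D j ω) k
  have h2 : 0 ≤ ∑ j ∈ Finset.Icc 1 k, l ^ 2 * (μ[fun ω ↦ ‖D j ω‖ ^ 2 | ℱ (j - 1)]) ω / 2 :=
    Finset.sum_nonneg fun j _ ↦ by have := hω j; positivity
  linarith

/-- Isolates `D (k + 1)`: every other factor is `ℱ k`-measurable, so the bound can be conditioned
term by term. -/
theorem expSqrtProcess_succ_le (l : ℝ) (k : ℕ) (ω : Ω) :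
    expSqrtProcess D ℱ μ l (k + 1) ω ≤
      (expSqrtProcess D ℱ μ l k ω *
        Real.exp (-(l ^ 2 * (μ[fun ω ↦ ‖D (k + 1) ω‖ ^ 2 | ℱ k]) ω / 2))) *
      (1 + inner ℝ ((l / √(1 + ‖∑ j ∈ Finset.Icc 1 k, l • D j ω‖ ^ 2)) •
        ∑ j ∈ Finset.Icc 1 k, l • D j ω) (D (k + 1) ω) + l ^ 2 / 2 * ‖D (k + 1) ω‖ ^ 2) := by
  have key := exp_sqrt_one_add_norm_add_sq_le (∑ j ∈ Finset.Icc 1 k, l • D j ω) (l • D (k + 1) ω)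
  simp only [expSqrtProcess]
  rw [Finset.sum_Icc_succ_top (by omega), Finset.sum_Icc_succ_top (by omega),
    Finset.sum_Icc_succ_top (by omega), Nat.add_sub_cancel]
  set S := ∑ j ∈ Finset.Icc 1 k, l • D j ω
  set A := ∑ j ∈ Finset.Icc 1 k, ‖l • D j ω‖ ^ 2
  set B := ∑ j ∈ Finset.Icc 1 k, l ^ 2 * (μ[fun ω ↦ ‖D j ω‖ ^ 2 | ℱ (j - 1)]) ω / 2
  set b := l ^ 2 * (μ[fun ω ↦ ‖D (k + 1) ω‖ ^ 2 | ℱ k]) ω / 2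
  have e1 : inner ℝ ((l / √(1 + ‖S‖ ^ 2)) • S) (D (k + 1) ω) =
      inner ℝ S (l • D (k + 1) ω) / √(1 + ‖S‖ ^ 2) := by
    rw [real_inner_smul_left, real_inner_smul_right]; ring
  have e2 : l ^ 2 / 2 * ‖D (k + 1) ω‖ ^ 2 = ‖l • D (k + 1) ω‖ ^ 2 / 2 := by
    rw [norm_smul, mul_pow, Real.norm_eq_abs, sq_abs]; ring
  rw [e1, e2]
  calc _ = Real.exp (√(1 + ‖S + l • D (k + 1) ω‖ ^ 2) - ‖l • D (k + 1) ω‖ ^ 2) *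
        (Real.exp (-A) * Real.exp (-B) * Real.exp (-b)) := by
        simp only [← Real.exp_add]; congr 1; ring
    _ ≤ _ := mul_le_mul_of_nonneg_right key (by positivity)
    _ = _ := by rw [sub_eq_add_neg √(1 + ‖S‖ ^ 2) A, Real.exp_add]; ring

theorem norm_div_sqrt_smul_le (l : ℝ) (s : H) : ‖(l / √(1 + ‖s‖ ^ 2)) • s‖ ≤ |l| := by
  have : ‖s‖ ≤ √(1 + ‖s‖ ^ 2) := Real.le_sqrt_of_sq_le (by linarith)
  have h1 : 0 < √(1 + ‖s‖ ^ 2) := Real.sqrt_pos.2 (by positivity)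
  rw [norm_smul, Real.norm_eq_abs, abs_div, abs_of_pos h1, div_mul_eq_mul_div, div_le_iff₀ h1]
  gcongr

theorem supermartingale_expSqrtProcess [IsFiniteMeasure μ] [CompleteSpace H]
    (hD : IsMartingaleDifference D ℱ μ) (hD_sq : ∀ j, 1 ≤ j → MemLp (D j) 2 μ) (l : ℝ) :
    Supermartingale (expSqrtProcess D ℱ μ l) ℱ μ := by
  have hmeas := stronglyMeasurable_expSqrtProcess (μ := μ) hD.stronglyMeasurable l
  have hint : ∀ k, Integrable (expSqrtProcess D ℱ μ l k) μ := fun k ↦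
    Integrable.of_bound ((hmeas k).mono (ℱ.le k)).aestronglyMeasurable (Real.exp (1 + k)) <| by
      filter_upwards [ae_expSqrtProcess_le (D := D) (ℱ := ℱ) (μ := μ) l k] with ω hω
      rwa [Real.norm_of_nonneg (expSqrtProcess_nonneg l k ω)]
  refine supermartingale_nat hmeas hint fun k ↦ ?_
  set V : Ω → ℝ := μ[fun ω ↦ ‖D (k + 1) ω‖ ^ 2 | ℱ k] with hV
  have hVnn : ∀ᵐ ω ∂μ, 0 ≤ V ω :=
    condExp_nonneg (Filter.Eventually.of_forall fun _ ↦ by positivity)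
  set W : Ω → ℝ := fun ω ↦ expSqrtProcess D ℱ μ l k ω * Real.exp (-(l ^ 2 * V ω / 2)) with hW
  have hWm : StronglyMeasurable[ℱ k] W := by
    refine (hmeas k).mul (Real.continuous_exp.comp_stronglyMeasurable (StronglyMeasurable.neg ?_))
    simp_rw [div_eq_mul_inv]
    exact (stronglyMeasurable_condExp.const_mul _).mul_const _
  have hWb : ∀ᵐ ω ∂μ, ‖W ω‖ ≤ Real.exp (1 + k) := by
    filter_upwards [ae_expSqrtProcess_le (D := D) (ℱ := ℱ) (μ := μ) l k, hVnn] with ω hω hv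
    have h0 := expSqrtProcess_nonneg (D := D) (ℱ := ℱ) (μ := μ) l k ω
    rw [Real.norm_of_nonneg (by positivity)]
    refine (mul_le_of_le_one_right h0 (Real.exp_le_one_iff.2 ?_)).trans hω
    have := mul_nonneg (sq_nonneg l) hv
    linarith
  have hWi : Integrable W μ := .of_bound (hWm.mono (ℱ.le k)).aestronglyMeasurable _ hWb
  set S : Ω → H := fun ω ↦ ∑ j ∈ Finset.Icc 1 k, l • D j ω with hS
  have hSm : StronglyMeasurable[ℱ k] S := stronglyMeasurable_sum_smul hD.stronglyMeasurable l k
  set g : Ω → H := fun ω ↦ W ω • (l / √(1 + ‖S ω‖ ^ 2)) • S ω with hg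
  have hgm : StronglyMeasurable[ℱ k] g := by
    have : StronglyMeasurable[ℱ k] fun ω ↦ l / √(1 + ‖S ω‖ ^ 2) := by
      refine ((by fun_prop (disch := intro x; positivity) :
        Continuous fun x : H ↦ l / √(1 + ‖x‖ ^ 2))).comp_stronglyMeasurable hSm
    exact hWm.smul (this.smul hSm)
  have hDi := hD.integrable (k + 1) (by omega)
  have hD2 : Integrable (fun ω ↦ ‖D (k + 1) ω‖ ^ 2) μ := (hD_sq (k + 1) (by omega)).norm.integrable_sq
  have hgD : Integrable (fun ω ↦ inner ℝ (g ω) (D (k + 1) ω)) μ := by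
    refine (hDi.norm.const_mul (Real.exp (1 + k) * |l|)).mono'
      ((hgm.mono (ℱ.le k)).aestronglyMeasurable.inner hDi.1) ?_
    filter_upwards [hWb] with ω hω
    refine (norm_inner_le_norm _ _).trans ?_
    gcongr
    rw [hg, norm_smul]
    exact mul_le_mul hω (norm_div_sqrt_smul_le l _) (norm_nonneg _) (Real.exp_pos _).le
  have hWD : Integrable (W * fun ω ↦ l ^ 2 / 2 * ‖D (k + 1) ω‖ ^ 2) μ :=
    (hD2.const_mul (l ^ 2 / 2)).bdd_mul (hWm.mono (ℱ.le k)).aestronglyMeasurable hWb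
  have c1 : μ[W | ℱ k] = W := condExp_of_stronglyMeasurable (ℱ.le k) hWm hWi
  have c2 : μ[fun ω ↦ inner ℝ (g ω) (D (k + 1) ω) | ℱ k] =ᵐ[μ]
      fun ω ↦ inner ℝ (g ω) ((μ[D (k + 1) | ℱ k]) ω) :=
    condExp_bilin_of_stronglyMeasurable_left (innerSL ℝ) hgm hgD hDi
  have c3 : μ[W * fun ω ↦ l ^ 2 / 2 * ‖D (k + 1) ω‖ ^ 2 | ℱ k] =ᵐ[μ]
      W * μ[fun ω ↦ l ^ 2 / 2 * ‖D (k + 1) ω‖ ^ 2 | ℱ k] :=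
    condExp_mul_of_stronglyMeasurable_left hWm hWD (hD2.const_mul _)
  have c4 : μ[fun ω ↦ l ^ 2 / 2 * ‖D (k + 1) ω‖ ^ 2 | ℱ k] =ᵐ[μ] fun ω ↦ l ^ 2 / 2 * V ω :=
    condExp_smul (l ^ 2 / 2) (fun ω ↦ ‖D (k + 1) ω‖ ^ 2) (ℱ k)
  have c5 : μ[D (k + 1) | ℱ k] =ᵐ[μ] 0 := hD.condExp_eq_zero (k + 1) (by omega)
  have hmono : μ[expSqrtProcess D ℱ μ l (k + 1) | ℱ k] ≤ᵐ[μ]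
      μ[W + (fun ω ↦ inner ℝ (g ω) (D (k + 1) ω)) +
        W * fun ω ↦ l ^ 2 / 2 * ‖D (k + 1) ω‖ ^ 2 | ℱ k] := by
    refine condExp_mono (hint (k + 1)) ((hWi.add hgD).add hWD) (Filter.Eventually.of_forall
      fun ω ↦ (expSqrtProcess_succ_le l k ω).trans_eq ?_)
    simp only [Pi.add_apply, Pi.mul_apply, hg, real_inner_smul_left, hW, hV, hS]
    ring
  filter_upwards [hmono, condExp_add (hWi.add hgD) hWD (ℱ k), condExp_add hWi hgD (ℱ k),
    c2, c3, c4, c5] with ω h a1 a2 c2 c3 c4 c5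
  rw [a1, Pi.add_apply, a2, Pi.add_apply, c1, c2, c3, Pi.mul_apply, c4, c5] at h
  refine h.trans ?_
  have h0 := expSqrtProcess_nonneg (D := D) (ℱ := ℱ) (μ := μ) l k ω
  -- The linear term has conditional mean zero; the compensator absorbs the remaining factor `1 + l²
  -- V / 2`.
  calc _ = expSqrtProcess D ℱ μ l k ω *
        (Real.exp (-(l ^ 2 * V ω / 2)) * (l ^ 2 * V ω / 2 + 1)) := by
        simp only [hW, Pi.zero_apply, inner_zero_right]; ring
    _ ≤ expSqrtProcess D ℱ μ l k ω * (Real.exp (-(l ^ 2 * V ω / 2)) * Real.exp (l ^ 2 * V ω / 2)) := by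
        gcongr; exact Real.add_one_le_exp _
    _ = _ := by rw [← Real.exp_add]; simp

/-- An exponential inequality for Hilbert space valued martingales, on the event where the
quadratic variation and the conditional quadratic variation are both bounded. -/
theorem measureReal_exists_lt_norm_sum_le [IsProbabilityMeasure μ] [CompleteSpace H]
    (hD : IsMartingaleDifference D ℱ μ) (hD_sq : ∀ j, 1 ≤ j → MemLp (D j) 2 μ)
    {l : ℝ} (hl : 0 ≤ l) (n : ℕ) (x a b : ℝ) :
    μ.real {ω | (∃ k ≤ n, x < ‖∑ j ∈ Finset.Icc 1 k, D j ω‖) ∧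
      ∑ j ∈ Finset.Icc 1 n, ‖D j ω‖ ^ 2 ≤ a ∧
      ∑ j ∈ Finset.Icc 1 n, (μ[fun ω ↦ ‖D j ω‖ ^ 2 | ℱ (j - 1)]) ω ≤ b} ≤
    Real.exp (1 - l * x + l ^ 2 * (a + b / 2)) := by
  have key := (supermartingale_expSqrtProcess hD hD_sq l).mul_measureReal_exists_le
    (expSqrtProcess_nonneg l) (Real.exp (l * x - l ^ 2 * (a + b / 2))) n
  have h0 : ∫ ω, expSqrtProcess D ℱ μ l 0 ω ∂μ = Real.exp 1 := by simp [expSqrtProcess]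
  rw [h0] at key
  have hle : μ.real {ω | ∃ k ≤ n, Real.exp (l * x - l ^ 2 * (a + b / 2)) ≤
      expSqrtProcess D ℱ μ l k ω} ≤ Real.exp (1 - l * x + l ^ 2 * (a + b / 2)) := by
    refine le_of_mul_le_mul_left (key.trans_eq ?_)
      (Real.exp_pos (l * x - l ^ 2 * (a + b / 2)))
    rw [← Real.exp_add]; congr 1; ring
  refine le_trans (ENNReal.toReal_mono (measure_ne_top _ _) (measure_mono_ae ?_)) hle
  filter_upwards [ae_condExp_norm_sq_nonneg (D := D) (ℱ := ℱ) (μ := μ)] with ω hω h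
  obtain ⟨⟨k, hk, hx⟩, ha, hb⟩ := h
  refine ⟨k, hk, ?_⟩
  rw [expSqrtProcess, ← Real.exp_add, Real.exp_le_exp]
  -- Both variations increase with time, so their bounds at `n` hold at the crossing time `k`.
  have hsub : Finset.Icc 1 k ⊆ Finset.Icc 1 n := Finset.Icc_subset_Icc_right hk
  have ha' : ∑ j ∈ Finset.Icc 1 k, ‖D j ω‖ ^ 2 ≤ a :=
    (Finset.sum_le_sum_of_subset_of_nonneg hsub fun _ _ _ ↦ by positivity).trans ha
  have hb' : ∑ j ∈ Finset.Icc 1 k, (μ[fun ω ↦ ‖D j ω‖ ^ 2 | ℱ (j - 1)]) ω ≤ b :=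
    (Finset.sum_le_sum_of_subset_of_nonneg hsub fun j _ _ ↦ hω j).trans hb
  have e1 : l * x ≤ √(1 + ‖∑ j ∈ Finset.Icc 1 k, l • D j ω‖ ^ 2) := by
    refine le_trans ?_ (Real.le_sqrt_of_sq_le (by linarith) :
      ‖∑ j ∈ Finset.Icc 1 k, l • D j ω‖ ≤ _)
    rw [← Finset.smul_sum, norm_smul, Real.norm_of_nonneg hl]
    gcongr
  have e2 : ∑ j ∈ Finset.Icc 1 k, ‖l • D j ω‖ ^ 2 ≤ l ^ 2 * a := by
    simp_rw [norm_smul, mul_pow, Real.norm_eq_abs, sq_abs, ← Finset.mul_sum]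
    gcongr
  have e3 : ∑ j ∈ Finset.Icc 1 k, l ^ 2 * (μ[fun ω ↦ ‖D j ω‖ ^ 2 | ℱ (j - 1)]) ω / 2 ≤
      l ^ 2 * b / 2 := by
    rw [← Finset.sum_div, ← Finset.mul_sum]
    gcongr
  linarith
end ExponentialSupermartingale

/-! ### Combination of the estimates -/

theorem mainTheorem7 {Ω H : Type*} {m0 : MeasurableSpace Ω}
    (μ : Measure Ω) [IsProbabilityMeasure μ]
    [NormedAddCommGroup H] [InnerProductSpace ℝ H] [CompleteSpace H]
    [TopologicalSpace.SeparableSpace H]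
    (ℱ : Filtration ℕ m0) (D : ℕ → Ω → H)
    (hD : IsMartingaleDifference D ℱ μ)
    (hD_sq : ∀ j, 1 ≤ j → MemLp (D j) 2 μ)
    (hD_var : ∀ j, 1 ≤ j →
      μ[fun ω => ‖D j ω‖ ^ 2 | ℱ (j - 1)] =ᵐ[μ] μ[fun ω => ‖D j ω‖ ^ 2 | ℱ 0])
    (n : ℕ) (hn : 1 ≤ n) (x y : ℝ) (hx : 0 < x) (hy : 0 < y) :
    IntegrableOn
      (fun u : ℝ => u * μ.real {ω | y * (u / 8) < √(∑ j ∈ Finset.Icc 1 n, ‖D j ω‖ ^ 2)})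
      (Set.Ioi 1) ∧
    μ.real {ω | x < (Finset.Icc 1 n).sup' (Finset.nonempty_Icc.mpr hn)
        (fun k => ‖∑ j ∈ Finset.Icc 1 k, D j ω‖)} ≤
      4 * Real.exp (-(x ^ 2 / y ^ 2)) +
      4 * ∫ u in Set.Ioi (1 : ℝ),
        u * μ.real {ω | y * (u / 8) < √(∑ j ∈ Finset.Icc 1 n, ‖D j ω‖ ^ 2)} := by

  set Q : Ω → ℝ := fun ω ↦ ∑ j ∈ Finset.Icc 1 n, ‖D j ω‖ ^ 2 with hQ
  have hQ0 : ∀ ω, 0 ≤ Q ω := fun ω ↦ Finset.sum_nonneg fun _ _ ↦ by positivity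
  have hQj : ∀ j ∈ Finset.Icc 1 n, Integrable (fun ω ↦ ‖D j ω‖ ^ 2) μ := fun j hj ↦
    (hD_sq j (Finset.mem_Icc.1 hj).1).norm.integrable_sq
  have hQi : Integrable Q μ := integrable_finsetSum _ hQj
  -- Chosen so that `R² = Q / t`, where `u < R` is the event in the integral.
  set t : ℝ := y ^ 2 / 64 with ht
  have ht0 : 0 < t := by positivity
  set R : Ω → ℝ := fun ω ↦ 8 / y * √(Q ω) with hR
  have hR2 : ∀ ω, R ω ^ 2 = Q ω / t := fun ω ↦ by
    rw [hR, mul_pow, Real.sq_sqrt (hQ0 ω), ht]; field_simp; ring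
  have hset : ∀ u : ℝ, {ω | y * (u / 8) < √(Q ω)} = {ω | u < R ω} := fun u ↦ by
    ext ω
    simp only [Set.mem_ofPred_eq, hR]
    rw [div_mul_eq_mul_div, lt_div_iff₀ hy]
    constructor <;> intro h <;> linarith
  obtain ⟨hI, hIeq⟩ := integrableOn_mul_measureReal_lt_and_integral_eq μ (R := R)
    (hQi.1.aemeasurable.sqrt.const_mul _) (fun ω ↦ by positivity)
    (by simp_rw [hR2]; exact hQi.div_const t)
  simp_rw [← hset] at hI hIeq
  refine ⟨hI, ?_⟩
  rw [hIeq]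
  have hIQ : ∫ ω, max (R ω ^ 2 - 1) 0 / 2 ∂μ = (∫ ω, max (Q ω - t) 0 ∂μ) / (2 * t) := by
    rw [← integral_div]
    congr 1 with ω
    rw [hR2, show Q ω / t - 1 = (Q ω - t) / t by field_simp,
      show (0 : ℝ) = 0 / t by simp, max_div_div_right ht0.le, zero_div, div_div, mul_comm t]
  rw [hIQ]
  set J := ∫ ω, max (Q ω - t) 0 ∂μ
  have hA : t * μ.real {ω | 2 * t < Q ω} ≤ J := by
    refine le_trans ?_ (mul_meas_ge_le_integral_of_nonneg (Filter.Eventually.of_forall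
      fun ω ↦ le_max_right _ _) (hQi.sub (integrable_const t)).pos_part t)
    gcongr
    · exact measure_ne_top _ _
    · intro h
      refine le_max_of_le_left ?_
      simp only [Pi.sub_apply]
      linarith
  have hB := measureReal_lt_condExp_le (ℱ.le 0) μ hQi ht0
  have hV : μ[Q | ℱ 0] =ᵐ[μ]
      fun ω ↦ ∑ j ∈ Finset.Icc 1 n, (μ[fun ω ↦ ‖D j ω‖ ^ 2 | ℱ (j - 1)]) ω := by
    have e : Q = ∑ j ∈ Finset.Icc 1 n, fun ω ↦ ‖D j ω‖ ^ 2 := by ext ω; simp [hQ]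
    rw [e]
    refine (condExp_finsetSum hQj (ℱ 0)).trans ?_
    have := (Finset.Icc 1 n).eventually_all.2 fun j hj ↦ hD_var j (Finset.mem_Icc.1 hj).1
    filter_upwards [this] with ω hω
    rw [Finset.sum_apply]
    exact Finset.sum_congr rfl fun j hj ↦ (hω j hj).symm
  -- With this `l` the exponent is `1 - (2 - 3/16) x² / y²`, which leaves room below `1 - x² / y²`;
  -- the prefactor 4 absorbs `e`.
  have hC := measureReal_exists_lt_norm_sum_le hD hD_sq (l := 2 * x / y ^ 2) (by positivity) n x
    (2 * t) (2 * t)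
  have hsplit : μ.real {ω | x < (Finset.Icc 1 n).sup' (Finset.nonempty_Icc.mpr hn)
      (fun k ↦ ‖∑ j ∈ Finset.Icc 1 k, D j ω‖)} ≤
      μ.real ({ω | (∃ k ≤ n, x < ‖∑ j ∈ Finset.Icc 1 k, D j ω‖) ∧
        ∑ j ∈ Finset.Icc 1 n, ‖D j ω‖ ^ 2 ≤ 2 * t ∧
        ∑ j ∈ Finset.Icc 1 n, (μ[fun ω ↦ ‖D j ω‖ ^ 2 | ℱ (j - 1)]) ω ≤ 2 * t} ∪
        ({ω | 2 * t < Q ω} ∪ {ω | 2 * t < (μ[Q | ℱ 0]) ω})) := by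
    refine ENNReal.toReal_mono (measure_ne_top _ _) (measure_mono_ae ?_)
    filter_upwards [hV] with ω hω h
    obtain ⟨k, hk, hkx⟩ := (Finset.lt_sup'_iff _).1 h
    by_cases h1 : Q ω ≤ 2 * t
    · by_cases h2 : (μ[Q | ℱ 0]) ω ≤ 2 * t
      · exact Or.inl ⟨⟨k, (Finset.mem_Icc.1 hk).2, hkx⟩, h1, hω ▸ h2⟩
      · exact Or.inr (Or.inr (not_le.1 h2))
    · exact Or.inr (Or.inl (not_le.1 h1))
  have hu1 := measureReal_union_le (μ := μ) {ω | 2 * t < Q ω} {ω | 2 * t < (μ[Q | ℱ 0]) ω}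
  have hexp : Real.exp (1 - 2 * x / y ^ 2 * x + (2 * x / y ^ 2) ^ 2 * (2 * t + 2 * t / 2)) ≤
      4 * Real.exp (-(x ^ 2 / y ^ 2)) := by
    have h4 : Real.exp 1 ≤ 4 := by linarith [Real.exp_one_lt_d9]
    refine le_trans ?_ (mul_le_mul_of_nonneg_right h4 (Real.exp_pos _).le)
    rw [← Real.exp_add, Real.exp_le_exp]
    have e : 1 - 2 * x / y ^ 2 * x + (2 * x / y ^ 2) ^ 2 * (2 * t + 2 * t / 2) =
        1 - (x ^ 2 / y ^ 2) * (2 - 3 / 16) := by rw [ht]; field_simp; ring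
    rw [e]
    have : 0 ≤ x ^ 2 / y ^ 2 := by positivity
    linarith
  -- One `J / t` for each of the two exceptional events.
  have hJ : 4 * (J / (2 * t)) = J / t + J / t := by field_simp; ring
  rw [mul_comm, ← le_div_iff₀ ht0] at hA hB
  refine hsplit.trans ((measureReal_union_le _ _).trans ?_)
  linarith
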